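/- **Notation.** $M(\mathbb{R}^n)$ is the set of complex Borel measures on $\mathbb{R}^n$, a unital Banach algebra under convolution $*$ and the total variation norm, with unit the Dirac measure $\delta_0$. A measure $\mu\in M(\mathbb{R}^n)$ is *invertible* if $\mu' * \mu=\delta_0$ for some $\mu'\in M(\mathbb{R}^n)$; $\exp(\nu)=\sum_{j\ge 0}\frac{1}{j!}\nu^{*j}$, with convergence in total variation norm and $\nu^{*0}=\delta_0$; $\widehat\mu(z)=\int_{\mathbb{R}^n} e^{i z^Tx}\,\mu(dx)$; and $\lambda^n$ is Lebesgue measure. Let $\mathcal{B}_0^n$ be the system of Borel sets $B\subset\mathbb{R}^n$ that are disjoint from $\{|x|\le r\}$ for some $r>0$. A *Lévy measure* is a positive Borel measure $\rho$ on $\mathbb{R}^n$ with $\rho(\{0\})=0$ and $\int\min(1,|x|^2)\,\rho(dx)<\infty$. A *complex Lévy type measure integrating $\min(1,|x|)$* is a set function $\nu:\mathcal{B}_0^n\to\mathbb{C}$ of the form $\nu=\rho_1-\rho_2+i(\rho_3-\rho_4)$ on $\mathcal{B}_0^n$ with Lévy measures $\rho_k$ satisfying $\int\min(1,|x|)\,\rho_k(dx)<\infty$;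 for measurable $h:\mathbb{R}^n\to\mathbb{C}$ with $|h(x)|\le C\min(1,|x|)$ for some constant $C$, put $\int h\,d\nu=\int h\,d\rho_1-\int h\,d\rho_2+i\left(\int h\,d\rho_3-\int h\,d\rho_4\right)$, which does not depend on the choice of the $\rho_k$. Finally, $\mathrm{CLK}_0^n$ is the set of all $\mu\in M(\mathbb{R}^n)$ for which there are $c\in\mathbb{C}\setminus\{0\}$, $\gamma\in\mathbb{R}^n$ and a complex Lévy type measure $\nu$ integrating $\min(1,|x|)$ such that $$\widehat\mu(z)=c\,\exp\Bigl(i\gamma^Tz+\int_{\mathbb{R}^n}\bigl(e^{iz^Tx}-1\bigr)\,\nu(dx)\Bigr)\qquad\text{for all } z\in\mathbb{R}^n.\tag{1}$$ **Theorem 4.3.** Let $n\ge 2$ and let $\mu\in M(\mathbb{R}^n)$ be of the form $\mu=\alpha\delta_0+f\lambda^n$ with $\alpha\in\mathbb{C}\setminus\{0\}$ and $f\in L^1(\mathbb{R}^n)$ complex-valued. Then the following are equivalent: - (i) $\mu$ is invertible. - (iv) $\mu\in\mathrm{CLK}_0^n$. - (v') $\mu\in\mathrm{CLK}_0^n$,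 where (1) holds with $\gamma=0$ and with a complex Lévy type measure $\nu$ of the form $\nu(dx)=g(x)\,\lambda^n(dx)$ for some complex-valued $g\in L^1(\mathbb{R}^n)$, that is, $\nu(B)=\int_B g\,d\lambda^n$ for all $B\in\mathcal{B}_0^n$. - (vi') There is $\nu'\in M(\mathbb{R}^n)$ such that $\mu=\exp(\nu')$. -/

import Mathlib

noncomputable section

open MeasureTheory Filter Topology Set
open scoped ENNReal

namespace InvertibleMeasures

/-- Euclidean space `ℝⁿ`. The set `M(ℝⁿ)` of complex Borel measures on it is
`ComplexMeasure (Eucl n)`. -/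
abbrev Eucl (n : ℕ) := EuclideanSpace ℝ (Fin n)

/-- Complex measures have finite total variation; hence products of complex measures exist and
bounded measurable functions are integrable with respect to them. -/
instance isFiniteMeasure_variation {X : Type*} [MeasurableSpace X] (μ : ComplexMeasure X) :
    IsFiniteMeasure μ.variation := by
  have hle : μ.variation ≤ (ComplexMeasure.re μ).variation + (ComplexMeasure.im μ).variation := by
    refine VectorMeasure.variation_le_of_forall_enorm_le fun s _ => ?_
    have h1 : ‖μ s‖ₑ ≤ ‖(μ s).re‖ₑ + ‖(μ s).im‖ₑ := by
      rw [← ofReal_norm, ← ofReal_norm, ← ofReal_norm,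
        ← ENNReal.ofReal_add (norm_nonneg _) (norm_nonneg _)]
      exact ENNReal.ofReal_le_ofReal (Complex.norm_le_abs_re_add_abs_im _)
    refine h1.trans ?_
    rw [Measure.add_apply]
    exact add_le_add
      (VectorMeasure.enorm_measure_le_variation (ComplexMeasure.re μ) s)
      (VectorMeasure.enorm_measure_le_variation (ComplexMeasure.im μ) s)
  rw [← SignedMeasure.totalVariation_eq_variation,
    ← SignedMeasure.totalVariation_eq_variation] at hle
  have h1 : IsFiniteMeasure (ComplexMeasure.re μ).totalVariation := by
    unfold SignedMeasure.totalVariation; infer_instance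
  have h2 : IsFiniteMeasure (ComplexMeasure.im μ).totalVariation := by
    unfold SignedMeasure.totalVariation; infer_instance
  exact isFiniteMeasure_of_le _ hle

/-! ### The convolution algebra `M(ℝⁿ)` -/

/-- The unit `δ₀` of the convolution algebra. -/
def delta0 (n : ℕ) : ComplexMeasure (Eucl n) := VectorMeasure.dirac 0 1

/-- Convolution of complex measures: the image of the product measure under addition. -/
def conv {n : ℕ} (μ ν : ComplexMeasure (Eucl n)) : ComplexMeasure (Eucl n) :=
  (μ.prod ν (ContinuousLinearMap.mul ℝ ℂ)).map fun p => p.1 + p.2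

/-- The `j`-fold convolution of `ν` with itself. -/
def convPow {n : ℕ} (ν : ComplexMeasure (Eucl n)) : ℕ → ComplexMeasure (Eucl n)
  | 0 => delta0 n
  | j + 1 => conv ν (convPow ν j)

/-- `μ` is invertible in the convolution algebra. -/
def IsInvertible {n : ℕ} (μ : ComplexMeasure (Eucl n)) : Prop :=
  ∃ μ' : ComplexMeasure (Eucl n), conv μ' μ = delta0 n

/-- `μ = exp ν`: the partial sums of `∑ j, ν^{*j} / j!` converge to `μ` in total variation norm. -/
def IsExp {n : ℕ} (ν μ : ComplexMeasure (Eucl n)) : Prop :=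
  Tendsto (fun N : ℕ =>
      (μ - ∑ j ∈ Finset.range N, ((j.factorial : ℂ)⁻¹) • convPow ν j).variation univ)
    atTop (𝓝 0)

/-- The characteristic function `z ↦ ∫ exp(i zᵀx) μ(dx)`. -/
def charFn {n : ℕ} (μ : ComplexMeasure (Eucl n)) (z : Eucl n) : ℂ :=
  μ.integral (fun x => Complex.exp (Complex.I * (inner ℝ z x : ℝ))) (ContinuousLinearMap.mul ℝ ℂ)

/-! ### Complex Lévy type measures -/

/-- The Borel sets that are bounded away from zero. -/
abbrev AwayFromZero (n : ℕ) : Type :=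
  {B : Set (Eucl n) // MeasurableSet B ∧ ∃ r : ℝ, 0 < r ∧ B ∩ Metric.closedBall 0 r = ∅}

/-- (Positive) Lévy measures. -/
def IsLevyMeasure {n : ℕ} (ρ : Measure (Eucl n)) : Prop :=
  ρ {0} = 0 ∧ ∫⁻ x, ENNReal.ofReal (min 1 (‖x‖ ^ 2)) ∂ρ < ∞

/-- `ν = ρ₀ - ρ₁ + i (ρ₂ - ρ₃)` on the sets bounded away from zero, for four Lévy measures `ρᵢ`
integrating `min(1, |x|)`. -/
structure IsLevyDecomp {n : ℕ} (ρ : Fin 4 → Measure (Eucl n)) (ν : AwayFromZero n → ℂ) :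
    Prop where
  levy : ∀ i, IsLevyMeasure (ρ i)
  lintegral_lt_top : ∀ i, ∫⁻ x, ENNReal.ofReal (min 1 ‖x‖) ∂(ρ i) < ∞
  eq : ∀ B : AwayFromZero n,
    ν B = ((ρ 0).real B.1 - (ρ 1).real B.1 : ℂ) + Complex.I * ((ρ 2).real B.1 - (ρ 3).real B.1 : ℂ)

/-- The set function `ν` is a complex Lévy type measure integrating `min(1, |x|)`. -/
def IsComplexLevyType {n : ℕ} (ν : AwayFromZero n → ℂ) : Prop :=
  ∃ ρ : Fin 4 → Measure (Eucl n), IsLevyDecomp ρ ν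

/-- `∫ f dρ₀ - ∫ f dρ₁ + i (∫ f dρ₂ - ∫ f dρ₃)`. -/
def decompIntegral {n : ℕ} (ρ : Fin 4 → Measure (Eucl n)) (f : Eucl n → ℂ) : ℂ :=
  (∫ x, f x ∂(ρ 0) - ∫ x, f x ∂(ρ 1)) + Complex.I * (∫ x, f x ∂(ρ 2) - ∫ x, f x ∂(ρ 3))

open Classical in
/-- The integral of `f` with respect to a complex Lévy type measure `ν` integrating `min(1, |x|)`,
for measurable `f` with `|f(x)| ≤ C min(1, |x|)`. It is computed from some decomposition of `ν`;
by `levyIntegral_eq` the value does not depend on which one. -/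
def levyIntegral {n : ℕ} (ν : AwayFromZero n → ℂ) (f : Eucl n → ℂ) : ℂ :=
  if h : IsComplexLevyType ν then decompIntegral h.choose f else 0

lemma integrable_of_le_min {n : ℕ} {ρ : Measure (Eucl n)}
    (hρ : ∫⁻ x, ENNReal.ofReal (min 1 ‖x‖) ∂ρ < ∞) {f : Eucl n → ℂ} (hf : Measurable f) {C : ℝ}
    (hC : ∀ x, ‖f x‖ ≤ C * min 1 ‖x‖) : Integrable f ρ := by
  have h : Integrable (fun x : Eucl n => min 1 ‖x‖) ρ := by
    refine ⟨by fun_prop, ?_⟩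
    rw [hasFiniteIntegral_iff_ofReal (ae_of_all _ fun x => by positivity)]
    exact hρ
  exact (h.const_mul C).mono' hf.aestronglyMeasurable (ae_of_all _ hC)

lemma measure_lt_top_of_away {n : ℕ} {ρ : Measure (Eucl n)}
    (hρ : ∫⁻ x, ENNReal.ofReal (min 1 ‖x‖) ∂ρ < ∞) (B : AwayFromZero n) : ρ B.1 < ∞ := by
  obtain ⟨B, hB, r, hr, hBr⟩ := B
  have hpos : (0 : ℝ) < min 1 r := lt_min one_pos hr
  have hsub : B ⊆ {x | ENNReal.ofReal (min 1 r) ≤ ENNReal.ofReal (min 1 ‖x‖)} := by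
    intro x hx
    refine ENNReal.ofReal_le_ofReal (min_le_min le_rfl ?_)
    by_contra! hlt
    exact (hBr ▸ (⟨hx, by simpa using hlt.le⟩ : x ∈ B ∩ Metric.closedBall 0 r) : x ∈ (∅ : Set _))
  refine (measure_mono hsub).trans_lt ?_
  exact meas_ge_le_lintegral_div (by fun_prop) (by simpa using hr) ENNReal.ofReal_ne_top
    |>.trans_lt (ENNReal.div_lt_top hρ.ne (by simpa using hr))

lemma measure_ext_of_away {n : ℕ} {ρ σ : Measure (Eucl n)} (h0 : ρ {0} = 0) (h0' : σ {0} = 0)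
    (h : ∀ B : AwayFromZero n, ρ B.1 = σ B.1) : ρ = σ := by
  ext s hs
  let A : ℕ → Set (Eucl n) := fun k => {x | (1 : ℝ) / (k + 1) < ‖x‖}
  have hA : Monotone fun k => s ∩ A k := by
    intro k l hkl x hx
    refine ⟨hx.1, lt_of_le_of_lt (b := (1 : ℝ) / (k + 1)) ?_ hx.2⟩
    exact one_div_le_one_div_of_le (by positivity) (by exact_mod_cast Nat.succ_le_succ hkl)
  have hAm : ∀ k, MeasurableSet (A k) := fun k => measurableSet_lt measurable_const measurable_norm
  have hU : (⋃ k, s ∩ A k) = s \ {0} := by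
    ext x
    simp only [mem_iUnion, mem_inter_iff, Set.mem_sdiff, mem_singleton_iff]
    constructor
    · rintro ⟨k, hx, hk⟩
      refine ⟨hx, fun h => ?_⟩
      subst h
      have : (0 : ℝ) < 1 / ((k : ℝ) + 1) := by positivity
      have hk' : (1 : ℝ) / (k + 1) < ‖(0 : Eucl n)‖ := hk
      rw [norm_zero] at hk'
      linarith
    · rintro ⟨hx, hne⟩
      obtain ⟨k, hk⟩ := exists_nat_one_div_lt (norm_pos_iff.2 hne)
      exact ⟨k, hx, hk⟩
  have key : ∀ τ : Measure (Eucl n), τ {0} = 0 → τ s = ⨆ k, τ (s ∩ A k) := by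
    intro τ hτ
    rw [← hA.measure_iUnion, hU, measure_sdiff_null hτ]
  rw [key ρ h0, key σ h0']
  refine iSup_congr fun k => ?_
  refine h ⟨s ∩ A k, hs.inter (hAm k), 1 / (k + 1), by positivity, ?_⟩
  ext x
  simp only [mem_inter_iff, Metric.mem_closedBall, dist_zero_right, mem_empty_iff_false, iff_false,
    not_and, not_le]
  exact fun hx => hx.2

/-- Each decomposition of a complex Lévy type measure integrating `min(1, |x|)` yields the same
integral. -/
theorem levyIntegral_eq {n : ℕ} {ρ : Fin 4 → Measure (Eucl n)} {ν : AwayFromZero n → ℂ}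
    (h : IsLevyDecomp ρ ν) {f : Eucl n → ℂ} (hf : Measurable f) {C : ℝ}
    (hC : ∀ x, ‖f x‖ ≤ C * min 1 ‖x‖) :
    levyIntegral ν f = decompIntegral ρ f := by
  have hex : IsComplexLevyType ν := ⟨ρ, h⟩
  rw [levyIntegral, dif_pos hex]
  have h' := hex.choose_spec
  generalize hex.choose = σ at h'
  have cancel : ∀ i j : Fin 4,
      (∀ B : AwayFromZero n,
        (σ i).real B.1 - (σ j).real B.1 = (ρ i).real B.1 - (ρ j).real B.1) →
      ∫ x, f x ∂(σ i) - ∫ x, f x ∂(σ j) = ∫ x, f x ∂(ρ i) - ∫ x, f x ∂(ρ j) := by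
    intro i j he
    have hm : σ i + ρ j = ρ i + σ j := by
      refine measure_ext_of_away (by simp [(h'.levy i).1, (h.levy j).1])
        (by simp [(h.levy i).1, (h'.levy j).1]) fun B => ?_
      have ta := (measure_lt_top_of_away (h'.lintegral_lt_top i) B).ne
      have tb := (measure_lt_top_of_away (h'.lintegral_lt_top j) B).ne
      have tc := (measure_lt_top_of_away (h.lintegral_lt_top i) B).ne
      have td := (measure_lt_top_of_away (h.lintegral_lt_top j) B).ne
      rw [Measure.add_apply, Measure.add_apply, ← ENNReal.toReal_eq_toReal_iff' (by simp [ta, td])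
        (by simp [tc, tb]), ENNReal.toReal_add ta td, ENNReal.toReal_add tc tb]
      have := he B
      simp only [Measure.real] at this
      linarith
    have hi : ∫ x, f x ∂(σ i + ρ j) = ∫ x, f x ∂(ρ i + σ j) := by rw [hm]
    rw [integral_add_measure (integrable_of_le_min (h'.lintegral_lt_top i) hf hC)
        (integrable_of_le_min (h.lintegral_lt_top j) hf hC),
      integral_add_measure (integrable_of_le_min (h.lintegral_lt_top i) hf hC)
        (integrable_of_le_min (h'.lintegral_lt_top j) hf hC)] at hi
    linear_combination hi
  rw [decompIntegral, decompIntegral,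
    cancel 0 1 fun B => by simpa using congrArg Complex.re ((h'.eq B).symm.trans (h.eq B)),
    cancel 2 3 fun B => by simpa using congrArg Complex.im ((h'.eq B).symm.trans (h.eq B))]

/-- The integrand of the Lévy–Khintchine type formula is bounded by a multiple of `min(1, |x|)`. -/
lemma norm_exp_sub_one_le {n : ℕ} (z x : Eucl n) :
    ‖Complex.exp (Complex.I * (inner ℝ z x : ℝ)) - 1‖ ≤ (2 + ‖z‖) * min 1 ‖x‖ := by
  have h1 : ‖Complex.exp (Complex.I * (inner ℝ z x : ℝ)) - 1‖ ≤ 2 := by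
    refine (norm_sub_le _ _).trans ?_
    rw [mul_comm, Complex.norm_exp_ofReal_mul_I, norm_one]
    norm_num
  have h2 : ‖Complex.exp (Complex.I * (inner ℝ z x : ℝ)) - 1‖ ≤ ‖z‖ * ‖x‖ :=
    (Real.norm_exp_I_mul_ofReal_sub_one_le).trans (norm_inner_le_norm z x)
  rcases le_total 1 ‖x‖ with h | h
  · rw [min_eq_left h]; nlinarith [norm_nonneg z]
  · rw [min_eq_right h]; nlinarith [norm_nonneg z, norm_nonneg x]

/-! ### Lévy–Khintchine type representations -/

/-- `μ` has the Lévy–Khintchine type representation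
`μ̂(z) = c exp (i γᵀz + ∫ (exp(i zᵀx) - 1) ν(dx))`, where `c ≠ 0` and `ν` is a complex Lévy type
measure integrating `min(1, |x|)`. -/
structure HasLKRep {n : ℕ} (μ : ComplexMeasure (Eucl n)) (c : ℂ) (γ : Eucl n)
    (ν : AwayFromZero n → ℂ) : Prop where
  ne_zero : c ≠ 0
  levyType : IsComplexLevyType ν
  charFn_eq : ∀ z : Eucl n, charFn μ z =
    c * Complex.exp (Complex.I * (inner ℝ γ z : ℝ) +
      levyIntegral ν fun x => Complex.exp (Complex.I * (inner ℝ z x : ℝ)) - 1)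

/-- The class `CLK₀ⁿ`. -/
def CLK (n : ℕ) : Set (ComplexMeasure (Eucl n)) :=
  {μ | ∃ (c : ℂ) (γ : Eucl n) (ν : AwayFromZero n → ℂ), HasLKRep μ c γ ν}

/-- `ν(dx) = g(x) dx`, as set functions on the sets bounded away from zero. -/
def HasDensity {n : ℕ} (ν : AwayFromZero n → ℂ) (g : Eucl n → ℂ) : Prop :=
  ∀ B : AwayFromZero n, ν B = ∫ x in B.1, g x

end InvertibleMeasures

end

/-!
Each of the four conditions is equivalent to `μ̂` having no zeros; the crux is to write a
nonvanishing `μ̂ = α (1 + 𝓕 f)` as `α exp (𝓕 g)` with `g ∈ L¹`. As `ℝⁿ` is simply connected,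
`1 + 𝓕 f` has a continuous logarithm `L`, and as the complement of a ball is connected when `n ≥ 2`,
`L` can be normalised to vanish at infinity. Near every point, infinity included, `L` is up to a
constant the logarithm of `1 + u` with `u` small in the Fourier algebra `𝓕 L¹`, because dilations
and translations move `L¹` functions little; there the power series of the logarithm applies. Cutoff
functions glue these local pieces to `L ∈ 𝓕 L¹`. The remaining implications are computations with
characteristic functions, which determine a complex measure.
-/

noncomputable section

open MeasureTheory Filter Topology Set
open scoped ENNReal FourierTransform SchwartzMap Convolution ContDiff

namespace InvertibleMeasures

/-! ### Continuous logarithms -/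

section ContinuousLog

variable {V : Type*} [NormedAddCommGroup V] [NormedSpace ℝ V]

lemma isPreconnected_compl_closedBall (h : 1 < Module.rank ℝ V) {R : ℝ} (hR : 0 ≤ R) :
    IsPreconnected (Metric.closedBall (0 : V) R)ᶜ := by
  have hprod : IsPreconnected (Ioi R ×ˢ Metric.sphere (0 : V) 1) :=
    isPreconnected_Ioi.prod (isPreconnected_sphere h 0 1)
  have himage : (Metric.closedBall (0 : V) R)ᶜ =
      (fun p : ℝ × V => p.1 • p.2) '' (Ioi R ×ˢ Metric.sphere (0 : V) 1) := by
    ext x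
    simp only [mem_compl_iff, mem_closedBall_zero_iff, not_le, mem_image, mem_prod, mem_Ioi,
      mem_sphere_zero_iff_norm, Prod.exists]
    constructor
    · intro hx
      have hx₀ : ‖x‖ ≠ 0 := (hR.trans_lt hx).ne'
      exact ⟨‖x‖, ‖x‖⁻¹ • x, ⟨hx, by rw [norm_smul, norm_inv, norm_norm, inv_mul_cancel₀ hx₀]⟩,
        smul_inv_smul₀ hx₀ x⟩
    · rintro ⟨r, y, ⟨hr, hy⟩, rfl⟩
      rwa [norm_smul, hy, mul_one, Real.norm_of_nonneg (hR.trans hr.le)]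
  rw [himage]
  exact hprod.image _ (by fun_prop)

lemma exists_continuous_exp_eq {φ : V → ℂ} (hφ : Continuous φ) (hne : ∀ ξ, φ ξ ≠ 0) :
    ∃ L : V → ℂ, Continuous L ∧ ∀ ξ, Complex.exp (L ξ) = φ ξ := by
  have huniv : SimplyConnectedSpace (univ : Set V) :=
    (Homeomorph.Set.univ V).toHomotopyEquiv.simplyConnectedSpace_iff.2 inferInstance
  obtain ⟨L, hL, hexp⟩ := Complex.exists_continuousOn_eqOn_exp_comp huniv isOpen_univ
    hφ.continuousOn (by rintro ⟨ξ, -, hξ⟩; exact hne ξ hξ)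
  exact ⟨L, continuousOn_univ.1 hL, fun ξ => hexp (mem_univ ξ)⟩

lemma exists_continuous_exp_eq_tendsto_zero [ProperSpace V] (hV : 1 < Module.rank ℝ V)
    {φ : V → ℂ} (hφ : Continuous φ) (hne : ∀ ξ, φ ξ ≠ 0) (hlim : Tendsto φ (cocompact V) (𝓝 1)) :
    ∃ L : V → ℂ, Continuous L ∧ (∀ ξ, Complex.exp (L ξ) = φ ξ) ∧
      Tendsto L (cocompact V) (𝓝 0) := by
  have : Nontrivial V := rank_pos_iff_nontrivial.1 (one_pos.trans hV)
  obtain ⟨L₀, hL₀c, hL₀⟩ := exists_continuous_exp_eq hφ hne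
  obtain ⟨R, hR₀, hR⟩ : ∃ R, 0 ≤ R ∧ ∀ ξ ∈ (Metric.closedBall (0 : V) R)ᶜ,
      φ ξ ∈ Complex.slitPlane := by
    have hev := hlim.eventually (Complex.isOpen_slitPlane.mem_nhds Complex.one_mem_slitPlane)
    obtain ⟨R, -, hR⟩ := (Metric.hasBasis_cobounded_compl_closedBall (0 : V)).mem_iff.1
      (Metric.cobounded_eq_cocompact (α := V) ▸ hev)
    refine ⟨max 0 R, le_max_left _ _, fun ξ hξ => hR fun h => hξ ?_⟩
    exact Metric.closedBall_subset_closedBall (le_max_right _ _) h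
  obtain ⟨ξ₁, hξ₁⟩ := NormedSpace.exists_lt_norm ℝ V R
  replace hξ₁ : ξ₁ ∈ (Metric.closedBall (0 : V) R)ᶜ := by simpa using hξ₁
  set c := L₀ ξ₁ - Complex.log (φ ξ₁) with hc
  have hexp_c : Complex.exp c = 1 := by
    rw [hc, Complex.exp_sub, hL₀, Complex.exp_log (hne ξ₁), div_self (hne ξ₁)]
  have heqOn : EqOn (fun ξ => L₀ ξ - c) (fun ξ => Complex.log (φ ξ))
      (Metric.closedBall (0 : V) R)ᶜ := by
    refine Complex.isCoveringMap_exp.eqOn_of_comp_eqOn (isPreconnected_compl_closedBall hV hR₀)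
      (hL₀c.sub continuous_const).continuousOn (hφ.continuousOn.clog hR) (fun ξ _ => ?_) hξ₁
      (by simp [hc])
    simp [Complex.exp_sub, hexp_c, hL₀, Complex.exp_log (hne ξ)]
  refine ⟨fun ξ => L₀ ξ - c, hL₀c.sub continuous_const, fun ξ => ?_, ?_⟩
  · rw [Complex.exp_sub, hL₀, hexp_c, div_one]
  · have hlog : Tendsto (fun ξ => Complex.log (φ ξ)) (cocompact V) (𝓝 0) := by
      simpa using hlim.clog Complex.one_mem_slitPlane
    refine hlog.congr' ?_
    filter_upwards [(isCompact_closedBall (0 : V) R).compl_mem_cocompact] with ξ hξ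
    exact (heqOn hξ).symm

end ContinuousLog

/-! ### The Fourier algebra -/

section FourierAlgebra

variable {V : Type*} [NormedAddCommGroup V] [InnerProductSpace ℝ V] [FiniteDimensional ℝ V]
  [MeasurableSpace V] [BorelSpace V]

/-- `u` is the Fourier transform of an integrable function of `L¹` norm at most `M`: the norm
bound in the Fourier algebra `𝓕 L¹(V)`, carried as a predicate on honest functions `V → ℂ`. -/
def FourierNormLE (u : V → ℂ) (M : ℝ) : Prop :=
  ∃ h : Lp ℂ 1 (volume : Measure V), (∀ ξ, Real.Lp.fourierTransform h ξ = u ξ) ∧ ‖h‖ ≤ M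

lemma FourierNormLE.of_integrable {f : V → ℂ} (hf : Integrable f) :
    FourierNormLE (𝓕 f) (∫ x, ‖f x‖) := by
  have hf' : MemLp f 1 := memLp_one_iff_integrable.2 hf
  refine ⟨hf'.toLp, fun ξ => by rw [Real.fourierTransform_toLp], ?_⟩
  rw [L1.norm_eq_integral_norm]
  exact (integral_congr_ae (hf'.coeFn_toLp.fun_comp norm)).le

lemma FourierNormLE.mono {u : V → ℂ} {M N : ℝ} (h : FourierNormLE u M) (hMN : M ≤ N) :
    FourierNormLE u N := by
  obtain ⟨f, hf, hM⟩ := h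
  exact ⟨f, hf, hM.trans hMN⟩

lemma FourierNormLE.exists_integrable {u : V → ℂ} {M : ℝ} (h : FourierNormLE u M) :
    ∃ f : V → ℂ, Integrable f ∧ 𝓕 f = u ∧ ∫ x, ‖f x‖ ≤ M := by
  obtain ⟨f, hf, hM⟩ := h
  exact ⟨f, L1.integrable_coeFn f, funext hf, by rwa [← L1.norm_eq_integral_norm]⟩

lemma FourierNormLE.comp_add_smul {u : V → ℂ} {M : ℝ} (hu : FourierNormLE u M) (a : V) {t : ℝ}
    (ht : t ≠ 0) : FourierNormLE (fun ξ => u (a + t • ξ)) M := by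
  obtain ⟨f, hf, rfl, hM⟩ := hu.exists_integrable
  set F : V → ℂ := fun x => |(t ^ Module.finrank ℝ V)|⁻¹ • 𝐞 (-inner ℝ x a) • f x with hF
  have hFi : Integrable F :=
    ((Real.fourierIntegral_convergent_iff a).2 hf).smul (|t ^ Module.finrank ℝ V|⁻¹)
  have hs : |t ^ Module.finrank ℝ V| ≠ 0 := abs_ne_zero.2 (pow_ne_zero _ ht)
  have hnorm : ∫ x, ‖F (t⁻¹ • x)‖ = ∫ x, ‖f x‖ := by
    rw [Measure.integral_comp_inv_smul volume fun x => ‖F x‖]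
    simp_rw [hF, norm_smul, Circle.norm_smul, integral_const_mul, norm_inv, smul_eq_mul,
      Real.norm_eq_abs, abs_abs, mul_inv_cancel_left₀ hs]
  have hfourier : 𝓕 (fun x => F (t⁻¹ • x)) = fun ξ => 𝓕 f (a + t • ξ) := by
    ext ξ
    have hcov := Measure.integral_comp_inv_smul volume (fun x => 𝐞 (-inner ℝ (t • x) ξ) • F x) t
    simp only [smul_inv_smul₀ ht] at hcov
    rw [Real.fourier_eq, hcov, ← integral_smul, Real.fourier_eq]
    refine integral_congr_ae (ae_of_all _ fun x => ?_)
    dsimp only [hF]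
    rw [smul_comm _ (|_|⁻¹), smul_inv_smul₀ hs, smul_smul, ← AddChar.map_add_eq_mul,
      inner_add_right, inner_smul_left, inner_smul_right, RCLike.conj_to_real, neg_add_rev]
  rw [← hfourier]
  exact (FourierNormLE.of_integrable (hFi.comp_smul (inv_ne_zero ht))).mono (hnorm.trans_le hM)

lemma fourierTransform_vadd (c : V) (f : Lp ℂ 1 (volume : Measure V)) (ξ : V) :
    Real.Lp.fourierTransform (DomAddAct.mk c +ᵥ f) ξ =
      𝐞 (inner ℝ c ξ) • Real.Lp.fourierTransform f ξ := by
  have h : 𝓕 (fun x => f (x + c)) ξ = 𝐞 (inner ℝ c ξ) • 𝓕 (f : V → ℂ) ξ :=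
    congrFun (VectorFourier.fourierIntegral_comp_add_right 𝐞 volume (innerₗ V) f c) ξ
  rw [Real.Lp.fourierTransform_apply, Real.Lp.fourierTransform_apply, ← h]
  refine Real.fourier_congr_ae ?_ ξ
  filter_upwards [DomAddAct.vadd_Lp_ae_eq (DomAddAct.mk c) f] with x hx
  rw [hx, add_comm x]
  rfl

lemma norm_vadd_sub_le (c : Vᵈᵃᵃ) (g : Lp ℂ 1 (volume : Measure V)) :
    ‖(c +ᵥ g) - g‖ ≤ 2 * ‖g‖ := by
  refine (norm_sub_le _ _).trans ?_
  rw [DomAddAct.norm_vadd_Lp, two_mul]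

lemma continuous_vadd_sub (g : Lp ℂ 1 (volume : Measure V)) :
    Continuous fun c : V => (DomAddAct.mk c +ᵥ g) - g :=
  haveI : Fact ((1 : ℝ≥0∞) ≠ ⊤) := ⟨ENNReal.one_ne_top⟩
  (DomAddAct.continuous_mk.vadd continuous_const).sub continuous_const

lemma integrable_smul_vadd_sub {w : V → ℂ} (hw : Integrable w) (t : ℝ)
    (g : Lp ℂ 1 (volume : Measure V)) :
    Integrable fun y => w y • ((DomAddAct.mk (-(t • y)) +ᵥ g) - g) := by
  have hcont : Continuous fun y : V => (DomAddAct.mk (-(t • y)) +ᵥ g) - g :=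
    (continuous_vadd_sub g).comp (continuous_const_smul t).neg
  refine (hw.norm.mul_const (2 * ‖g‖)).mono'
    (hw.aestronglyMeasurable.smul hcont.aestronglyMeasurable) (ae_of_all _ fun y => ?_)
  rw [norm_smul]
  gcongr
  exact norm_vadd_sub_le _ g

lemma fourierTransform_integral_smul_vadd {w : V → ℂ} (hw : Integrable w) (t : ℝ)
    (g : Lp ℂ 1 (volume : Measure V)) (ξ : V) :
    Real.Lp.fourierTransform (∫ y, w y • ((DomAddAct.mk (-(t • y)) +ᵥ g) - g)) ξ =
      (𝓕 w (t • ξ) - 𝓕 w 0) * Real.Lp.fourierTransform g ξ := by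
  have hcomm := ((BoundedContinuousFunction.evalCLM ℂ ξ).comp
    (Real.Lp.fourierTransformCLM V ℂ)).integral_comp_comm (integrable_smul_vadd_sub hw t g)
  simp only [ContinuousLinearMap.comp_apply, map_smul, map_sub,
    Real.Lp.fourierTransformCLM_apply, BoundedContinuousFunction.evalCLM_apply,
    fourierTransform_vadd] at hcomm
  have hconv (η : V) : Integrable fun y => 𝐞 (-inner ℝ y η) • w y :=
    (Real.fourierIntegral_convergent_iff η).2 hw
  rw [← hcomm, Real.fourier_eq, Real.fourier_eq, ← integral_sub (hconv _) (hconv _),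
    ← integral_mul_const]
  congr with y
  simp only [Circle.smul_def, smul_eq_mul, inner_neg_left, real_inner_smul_left,
    real_inner_smul_right, inner_zero_right, neg_zero, AddChar.map_zero_eq_one, Circle.coe_one]
  ring

lemma FourierNormLE.eventually_sub_mul {u v : V → ℂ} {M N ε : ℝ} (hu : FourierNormLE u M)
    (hv : FourierNormLE v N) (hε : 0 < ε) :
    ∀ᶠ t : ℝ in 𝓝 0, FourierNormLE (fun ξ => (u (t • ξ) - u 0) * v ξ) ε := by
  obtain ⟨f, hf, rfl, -⟩ := hu.exists_integrable
  obtain ⟨g, hg, -⟩ := hv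
  have hlim : Tendsto (fun t : ℝ => ∫ y, f y • ((DomAddAct.mk (-(t • y)) +ᵥ g) - g))
      (𝓝 0) (𝓝 0) := by
    rw [← integral_zero V (Lp ℂ 1 (volume : Measure V))]
    refine tendsto_integral_filter_of_dominated_convergence (fun y => ‖f y‖ * (2 * ‖g‖))
      (.of_forall fun t => (integrable_smul_vadd_sub hf t g).aestronglyMeasurable)
      (.of_forall fun t => ae_of_all _ fun y => ?_) (hf.norm.mul_const _)
      (ae_of_all _ fun y => ?_)
    · rw [norm_smul]
      gcongr
      exact norm_vadd_sub_le _ g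
    · have hcont : Continuous fun t : ℝ => (DomAddAct.mk (-(t • y)) +ᵥ g) - g :=
        (continuous_vadd_sub g).comp (by fun_prop)
      simpa using (hcont.tendsto 0).const_smul (f y)
  filter_upwards [hlim.norm.eventually_le_const (by simpa using hε)] with t ht
  exact ⟨_, fun ξ => by rw [fourierTransform_integral_smul_vadd hf, hg], ht⟩

lemma FourierNormLE.nonneg {u : V → ℂ} {M : ℝ} (h : FourierNormLE u M) : 0 ≤ M := by
  obtain ⟨f, -, hM⟩ := h
  exact (norm_nonneg f).trans hM

lemma FourierNormLE.norm_le {u : V → ℂ} {M : ℝ} (h : FourierNormLE u M) (ξ : V) : ‖u ξ‖ ≤ M := by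
  obtain ⟨f, -, rfl, hM⟩ := h.exists_integrable
  exact (VectorFourier.norm_fourierIntegral_le_integral_norm _ _ _ _ _).trans hM

lemma FourierNormLE.add {u v : V → ℂ} {M N : ℝ} (hu : FourierNormLE u M)
    (hv : FourierNormLE v N) : FourierNormLE (fun ξ => u ξ + v ξ) (M + N) := by
  obtain ⟨f, hf, hM⟩ := hu
  obtain ⟨g, hg, hN⟩ := hv
  refine ⟨f + g, fun ξ => ?_, (norm_add_le f g).trans (add_le_add hM hN)⟩
  rw [← Real.Lp.fourierTransformCLM_apply, map_add]
  simp [hf, hg, -Real.Lp.fourierTransform_apply]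

lemma FourierNormLE.const_mul {u : V → ℂ} {M : ℝ} (hu : FourierNormLE u M) (c : ℂ) :
    FourierNormLE (fun ξ => c * u ξ) (‖c‖ * M) := by
  obtain ⟨f, hf, hM⟩ := hu
  refine ⟨c • f, fun ξ => ?_, (norm_smul_le c f).trans (by gcongr)⟩
  rw [← Real.Lp.fourierTransformCLM_apply, map_smul]
  simp [hf, -Real.Lp.fourierTransform_apply]

lemma integral_norm_convolution_le {f g : V → ℂ} (hf : Integrable f) (hg : Integrable g) :
    ∫ x, ‖(f ⋆[ContinuousLinearMap.mul ℂ ℂ] g) x‖ ≤ (∫ x, ‖f x‖) * ∫ x, ‖g x‖ :=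
  calc ∫ x, ‖(f ⋆[ContinuousLinearMap.mul ℂ ℂ] g) x‖
      ≤ ∫ x, ((fun x => ‖f x‖) ⋆[ContinuousLinearMap.mul ℝ ℝ] fun x => ‖g x‖) x := by
        refine integral_mono (hf.integrable_convolution _ hg).norm
          (hf.norm.integrable_convolution _ hg.norm) fun x => ?_
        refine (norm_integral_le_integral_norm _).trans_eq ?_
        simp [convolution_def]
    _ = (∫ x, ‖f x‖) * ∫ x, ‖g x‖ := integral_convolution _ hf.norm hg.norm

lemma FourierNormLE.mul {u v : V → ℂ} {M N : ℝ} (hu : FourierNormLE u M)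
    (hv : FourierNormLE v N) : FourierNormLE (fun ξ => u ξ * v ξ) (M * N) := by
  have hM₀ := hu.nonneg
  obtain ⟨f, hf, rfl, hM⟩ := hu.exists_integrable
  obtain ⟨g, hg, rfl, hN⟩ := hv.exists_integrable
  have hfg : 𝓕 (f ⋆[ContinuousLinearMap.mul ℂ ℂ] g) = fun ξ => 𝓕 f ξ * 𝓕 g ξ :=
    funext (Real.fourier_mul_convolution_eq hf hg)
  rw [← hfg]
  refine (FourierNormLE.of_integrable (hf.integrable_convolution _ hg)).mono ?_
  exact (integral_norm_convolution_le hf hg).trans (by gcongr)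

lemma FourierNormLE.pow_succ {u : V → ℂ} {M : ℝ} (hu : FourierNormLE u M) (k : ℕ) :
    FourierNormLE (fun ξ => u ξ ^ (k + 1)) (M ^ (k + 1)) := by
  induction k with
  | zero => simpa using hu
  | succ k ih => simpa only [_root_.pow_succ _ (k + 1)] using ih.mul hu

lemma FourierNormLE.of_hasSum {u : ℕ → V → ℂ} {M : ℕ → ℝ} {s : V → ℂ}
    (hu : ∀ k, FourierNormLE (u k) (M k)) (hM : Summable M)
    (hs : ∀ ξ, HasSum (fun k => u k ξ) (s ξ)) : FourierNormLE s (∑' k, M k) := by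
  choose f hf hfM using hu
  have hsum : Summable fun k => ‖f k‖ := hM.of_nonneg_of_le (fun k => norm_nonneg _) hfM
  refine ⟨∑' k, f k, fun ξ => ?_, (norm_tsum_le_tsum_norm hsum).trans (hsum.tsum_le_tsum hfM hM)⟩
  have hf_sum := hsum.of_norm.hasSum.mapL
    ((BoundedContinuousFunction.evalCLM ℂ ξ).comp (Real.Lp.fourierTransformCLM V ℂ))
  simp only [ContinuousLinearMap.comp_apply, Real.Lp.fourierTransformCLM_apply,
    BoundedContinuousFunction.evalCLM_apply, hf] at hf_sum
  exact hf_sum.unique (hs ξ)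

lemma FourierNormLE.log_one_add {u : V → ℂ} {M : ℝ} (hu : FourierNormLE u M) (hM : M < 1) :
    FourierNormLE (fun ξ => Complex.log (1 + u ξ)) (∑' k, M ^ (k + 1)) := by
  have hterm (k : ℕ) : FourierNormLE
      (fun ξ => (-1) ^ (k + 1 + 1) / ((k + 1 : ℕ) : ℂ) * u ξ ^ (k + 1)) (M ^ (k + 1)) := by
    refine ((hu.pow_succ k).const_mul _).mono
      (mul_le_of_le_one_left (pow_nonneg hu.nonneg _) ?_)
    rw [norm_div, norm_pow, norm_neg, norm_one, one_pow, Complex.norm_natCast]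
    exact div_le_one_of_le₀ (by norm_cast; lia) (by positivity)
  have hsum : Summable fun k : ℕ => M ^ (k + 1) :=
    (summable_nat_add_iff 1).2 (summable_geometric_of_lt_one hu.nonneg hM)
  refine FourierNormLE.of_hasSum hterm hsum fun ξ => ?_
  have htaylor := Complex.hasSum_taylorSeries_log ((hu.norm_le ξ).trans_lt hM)
  rw [← hasSum_nat_add_iff' 1] at htaylor
  simpa [div_mul_eq_mul_div] using htaylor

/-- `u` belongs to the Fourier algebra `𝓕 L¹(V)`. -/
def MemFourierAlgebra (u : V → ℂ) : Prop := ∃ M, FourierNormLE u M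

lemma FourierNormLE.mem {u : V → ℂ} {M : ℝ} (hu : FourierNormLE u M) : MemFourierAlgebra u :=
  ⟨M, hu⟩

lemma MemFourierAlgebra.add {u v : V → ℂ} (hu : MemFourierAlgebra u) (hv : MemFourierAlgebra v) :
    MemFourierAlgebra fun ξ => u ξ + v ξ :=
  (hu.choose_spec.add hv.choose_spec).mem

lemma MemFourierAlgebra.const_mul {u : V → ℂ} (hu : MemFourierAlgebra u) (c : ℂ) :
    MemFourierAlgebra fun ξ => c * u ξ :=
  (hu.choose_spec.const_mul c).mem

lemma MemFourierAlgebra.sub {u v : V → ℂ} (hu : MemFourierAlgebra u) (hv : MemFourierAlgebra v) :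
    MemFourierAlgebra fun ξ => u ξ - v ξ := by
  simpa [sub_eq_add_neg] using hu.add (hv.const_mul (-1))

lemma MemFourierAlgebra.mul {u v : V → ℂ} (hu : MemFourierAlgebra u) (hv : MemFourierAlgebra v) :
    MemFourierAlgebra fun ξ => u ξ * v ξ :=
  (hu.choose_spec.mul hv.choose_spec).mem

lemma memFourierAlgebra_of_contDiff {u : V → ℂ} (hu : ContDiff ℝ ∞ u) (hc : HasCompactSupport u) :
    MemFourierAlgebra u := by
  let F : 𝓢(V, ℂ) := 𝓕⁻ (hc.toSchwartzMap hu)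
  have hF : 𝓕 (F : V → ℂ) = u := by
    rw [← SchwartzMap.fourier_coe, FourierTransform.fourier_fourierInv_eq]
    rfl
  exact hF ▸ (FourierNormLE.of_integrable F.integrable).mem

lemma memFourierAlgebra_contDiffBump {c : V} (b : ContDiffBump c) :
    MemFourierAlgebra fun ξ => (b ξ : ℂ) :=
  memFourierAlgebra_of_contDiff (Complex.ofRealCLM.contDiff.comp b.contDiff)
    (b.hasCompactSupport.comp_left Complex.ofReal_zero)

lemma MemFourierAlgebra.exists_cutoff_sub_mul {u : V → ℂ} (hu : MemFourierAlgebra u) (ξ₀ : V)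
    {ε : ℝ} (hε : 0 < ε) : ∃ χ : V → ℂ, MemFourierAlgebra χ ∧ χ =ᶠ[𝓝 ξ₀] 1 ∧
      FourierNormLE (fun ξ => (u ξ - u ξ₀) * χ ξ) ε := by
  obtain ⟨M, hu⟩ := hu
  let b : ContDiffBump (0 : V) := default
  obtain ⟨N, hb⟩ := memFourierAlgebra_contDiffBump b
  have hsmall := (hu.comp_add_smul ξ₀ one_ne_zero).eventually_sub_mul hb hε
  obtain ⟨t, ht, ht₀⟩ := ((hsmall.filter_mono nhdsWithin_le_nhds).and
    (self_mem_nhdsWithin (s := {0}ᶜ))).exists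
  have hinv : t⁻¹ ≠ 0 := inv_ne_zero ht₀
  refine ⟨fun ξ => b (-(t⁻¹ • ξ₀) + t⁻¹ • ξ), (hb.comp_add_smul _ hinv).mem, ?_, ?_⟩
  · have hcont : Tendsto (fun ξ => -(t⁻¹ • ξ₀) + t⁻¹ • ξ) (𝓝 ξ₀) (𝓝 0) := by
      have : Continuous fun ξ => -(t⁻¹ • ξ₀) + t⁻¹ • ξ := by fun_prop
      simpa using this.tendsto ξ₀
    filter_upwards [hcont.eventually b.eventuallyEq_one] with ξ hξ
    simp [hξ]
  · simpa [smul_add, smul_inv_smul₀ ht₀] using ht.comp_add_smul (-(t⁻¹ • ξ₀)) hinv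

lemma MemFourierAlgebra.exists_hasCompactSupport_sub_mul {u : V → ℂ} (hu : MemFourierAlgebra u)
    {ε : ℝ} (hε : 0 < ε) : ∃ θ : V → ℂ, HasCompactSupport θ ∧
      FourierNormLE (fun ξ => (1 - θ ξ) * u ξ) ε := by
  obtain ⟨M, hu⟩ := hu
  let b : ContDiffBump (0 : V) := default
  obtain ⟨N, hb⟩ := memFourierAlgebra_contDiffBump b
  obtain ⟨t, ht, ht₀⟩ := (((hb.eventually_sub_mul hu hε).filter_mono nhdsWithin_le_nhds).and
    (self_mem_nhdsWithin (s := {0}ᶜ))).exists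
  refine ⟨fun ξ => b (t • ξ), (b.hasCompactSupport.comp_smul ht₀).comp_left Complex.ofReal_zero, ?_⟩
  have hb₀ : b 0 = 1 := b.eventuallyEq_one.self_of_nhds
  convert! ht.const_mul (-1) using 1
  · ext ξ
    simp only [hb₀, Complex.ofReal_one]
    ring
  · simp

lemma exists_cutoff_mul_mem_of_eventuallyEq {u v : V → ℂ} {ξ : V} (hv : MemFourierAlgebra v)
    (huv : u =ᶠ[𝓝 ξ] v) : ∃ s ∈ 𝓝 ξ, ∃ χ : V → ℂ, MemFourierAlgebra χ ∧ EqOn χ 1 s ∧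
      MemFourierAlgebra fun η => χ η * u η := by
  obtain ⟨r, hr, hball⟩ := Metric.eventually_nhds_iff_ball.1 huv
  let b : ContDiffBump ξ := ⟨r / 2, r, half_pos hr, half_lt_self hr⟩
  have hb := memFourierAlgebra_contDiffBump b
  refine ⟨_, b.eventuallyEq_one, fun η => b η, hb, fun η (hη : b η = 1) => by simp [hη], ?_⟩
  convert hb.mul hv using 2 with η
  by_cases hη : η ∈ Metric.ball ξ r
  · rw [hball η hη]
  · have hbη : b η = 0 := b.zero_of_le_dist (not_lt.1 hη)
    simp [hbη]

lemma exists_cutoff_mul_mem_of_isCompact {u : V → ℂ} {K : Set V} (hK : IsCompact K)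
    (hloc : ∀ ξ ∈ K, ∃ v, MemFourierAlgebra v ∧ u =ᶠ[𝓝 ξ] v) :
    ∃ χ : V → ℂ, MemFourierAlgebra χ ∧ EqOn χ 1 K ∧ MemFourierAlgebra fun ξ => χ ξ * u ξ := by
  refine hK.induction_on (p := fun s => ∃ χ : V → ℂ, MemFourierAlgebra χ ∧
    EqOn χ 1 s ∧ MemFourierAlgebra fun ξ => χ ξ * u ξ) ?_ ?_ ?_ ?_
  · have hzero : MemFourierAlgebra fun _ : V => (0 : ℂ) :=
      memFourierAlgebra_of_contDiff contDiff_const .zero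
    exact ⟨_, hzero, eqOn_empty _ _, by simpa using hzero⟩
  · rintro s t hst ⟨χ, hχ, hχ₁, hχu⟩
    exact ⟨χ, hχ, hχ₁.mono hst, hχu⟩
  · rintro s t ⟨χ, hχ, hχ₁, hχu⟩ ⟨ψ, hψ, hψ₁, hψu⟩
    refine ⟨fun ξ => χ ξ + ψ ξ - χ ξ * ψ ξ, (hχ.add hψ).sub (hχ.mul hψ), ?_, ?_⟩
    · rintro ξ (hξ | hξ)
      · simp [hχ₁ hξ]
      · simp [hψ₁ hξ]
    · simpa only [sub_mul, add_mul, mul_assoc] using (hχu.add hψu).sub (hχ.mul hψu)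
  · intro ξ hξ
    obtain ⟨v, hv, huv⟩ := hloc ξ hξ
    obtain ⟨s, hs, hχ⟩ := exists_cutoff_mul_mem_of_eventuallyEq hv huv
    exact ⟨s, mem_nhdsWithin_of_mem_nhds hs, hχ⟩

lemma memFourierAlgebra_of_locally {u : V → ℂ} (hc : HasCompactSupport u)
    (hloc : ∀ ξ, ∃ v, MemFourierAlgebra v ∧ u =ᶠ[𝓝 ξ] v) : MemFourierAlgebra u := by
  obtain ⟨χ, -, hχ, hχu⟩ := exists_cutoff_mul_mem_of_isCompact hc.isCompact fun ξ _ => hloc ξ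
  convert hχu using 1
  ext ξ
  by_cases hξ : ξ ∈ tsupport u
  · simp [hχ hξ]
  · simp [image_eq_zero_of_notMem_tsupport hξ]

lemma continuous_fourier {f : V → ℂ} (hf : Integrable f) : Continuous (𝓕 f) :=
  VectorFourier.fourierIntegral_continuous Real.continuous_fourierChar (innerSL ℝ).continuous₂ hf

lemma eventually_log_exp {X : Type*} {l : Filter X} {L : X → ℂ} (hL : Tendsto L l (𝓝 0)) :
    ∀ᶠ x in l, Complex.log (Complex.exp (L x)) = L x := by
  have him : Tendsto (fun x => (L x).im) l (𝓝 0) :=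
    (Complex.continuous_im.tendsto' 0 0 rfl).comp hL
  filter_upwards [him.eventually (Ioo_mem_nhds (neg_lt_zero.2 Real.pi_pos) Real.pi_pos)] with x hx
  exact Complex.log_exp hx.1 hx.2.le

lemma MemFourierAlgebra.exists_eventuallyEq_log {u L : V → ℂ} (hu : MemFourierAlgebra u)
    (hL : Continuous L) (hexp : ∀ ξ, Complex.exp (L ξ) = 1 + u ξ) (ξ₀ : V) :
    ∃ v, MemFourierAlgebra v ∧ L =ᶠ[𝓝 ξ₀] v := by
  have hne : 1 + u ξ₀ ≠ 0 := hexp ξ₀ ▸ Complex.exp_ne_zero _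
  obtain ⟨χ, hχ, hχ₁, hsmall⟩ :=
    hu.exists_cutoff_sub_mul ξ₀ (ε := ‖1 + u ξ₀‖ / 2) (by positivity)
  have hlog := (hsmall.const_mul (1 + u ξ₀)⁻¹).log_one_add (by
    rw [norm_inv, mul_div_assoc', inv_mul_cancel₀ (norm_ne_zero_iff.2 hne)]; norm_num)
  refine ⟨_, (hχ.const_mul (L ξ₀)).add hlog.mem, ?_⟩
  have hL₀ : Tendsto (fun ξ => L ξ - L ξ₀) (𝓝 ξ₀) (𝓝 0) := by
    simpa using (hL.sub continuous_const).tendsto ξ₀ (f := fun ξ => L ξ - L ξ₀)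
  filter_upwards [hχ₁, eventually_log_exp hL₀] with ξ hχξ hlogξ
  have hquot : 1 + (1 + u ξ₀)⁻¹ * (u ξ - u ξ₀) = Complex.exp (L ξ - L ξ₀) := by
    rw [Complex.exp_sub, hexp, hexp]
    field_simp
    ring
  simp only [hχξ, Pi.one_apply, mul_one, hquot, hlogξ]
  ring

lemma MemFourierAlgebra.exists_eventuallyEq_log_cocompact {u L : V → ℂ} (hu : MemFourierAlgebra u)
    (hL : Tendsto L (cocompact V) (𝓝 0)) (hexp : ∀ ξ, Complex.exp (L ξ) = 1 + u ξ) :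
    ∃ v, MemFourierAlgebra v ∧ L =ᶠ[cocompact V] v := by
  obtain ⟨θ, hθ, hsmall⟩ := hu.exists_hasCompactSupport_sub_mul one_half_pos
  refine ⟨_, (hsmall.log_one_add one_half_lt_one).mem, ?_⟩
  rw [hasCompactSupport_iff_eventuallyEq, coclosedCompact_eq_cocompact] at hθ
  filter_upwards [hθ, eventually_log_exp hL] with ξ hθξ hlogξ
  rw [hθξ, Pi.zero_apply, sub_zero, one_mul, ← hexp, hlogξ]

lemma MemFourierAlgebra.of_exp_eq_one_add {u L : V → ℂ} (hu : MemFourierAlgebra u)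
    (hL : Continuous L) (hL₀ : Tendsto L (cocompact V) (𝓝 0))
    (hexp : ∀ ξ, Complex.exp (L ξ) = 1 + u ξ) : MemFourierAlgebra L := by
  obtain ⟨v, hv, hLv⟩ := hu.exists_eventuallyEq_log_cocompact hL₀ hexp
  have hc : HasCompactSupport fun ξ => L ξ - v ξ := by
    rw [hasCompactSupport_iff_eventuallyEq, coclosedCompact_eq_cocompact]
    filter_upwards [hLv] with ξ hξ
    simp [hξ]
  have hdiff : MemFourierAlgebra fun ξ => L ξ - v ξ := by
    refine memFourierAlgebra_of_locally hc fun ξ => ?_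
    obtain ⟨w, hw, hLw⟩ := hu.exists_eventuallyEq_log hL hexp ξ
    exact ⟨_, hw.sub hv, hLw.sub (EventuallyEq.refl _ v)⟩
  simpa using hdiff.add hv

/-- The **Wiener–Lévy theorem** for the logarithm. -/
theorem exists_exp_fourier_eq (hV : 1 < Module.rank ℝ V) {f : V → ℂ} (hf : Integrable f)
    (hne : ∀ ξ, 1 + 𝓕 f ξ ≠ 0) :
    ∃ g : V → ℂ, Integrable g ∧ ∀ ξ, Complex.exp (𝓕 g ξ) = 1 + 𝓕 f ξ := by
  have hlim : Tendsto (fun ξ => 1 + 𝓕 f ξ) (cocompact V) (𝓝 1) := by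
    have hf₀ : Tendsto (𝓕 f) (cocompact V) (𝓝 0) := tendsto_integral_exp_inner_smul_cocompact f
    simpa using hf₀.const_add 1
  obtain ⟨L, hL, hexp, hL₀⟩ :=
    exists_continuous_exp_eq_tendsto_zero hV (continuous_const.add (continuous_fourier hf)) hne hlim
  obtain ⟨M, hLM⟩ := (FourierNormLE.of_integrable hf).mem.of_exp_eq_one_add hL hL₀ hexp
  obtain ⟨g, hg, rfl, -⟩ := hLM.exists_integrable
  exact ⟨g, hg, hexp⟩

end FourierAlgebra

/-! ### Complex measures -/

section Density

variable {X Y : Type*} [MeasurableSpace X] [MeasurableSpace Y]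

lemma integrable_of_forall_norm_le (μ : ComplexMeasure X) {f : X → ℂ} (hf : Measurable f) {C : ℝ}
    (hC : ∀ x, ‖f x‖ ≤ C) : μ.Integrable f :=
  Integrable.of_bound hf.aestronglyMeasurable C (ae_of_all _ hC)

lemma integral_simpleFunc_withDensityᵥ {p : Measure X} {g : X → ℂ} (hg : Integrable g p)
    (F : SimpleFunc X ℂ) :
    (p.withDensityᵥ g).integral F (ContinuousLinearMap.mul ℝ ℂ) = ∫ x, F x * g x ∂p := by
  induction F using SimpleFunc.induction with
  | const c hs =>
    rename_i s
    have hind (x : X) : s.indicator (fun _ => c) x * g x = s.indicator (fun x => c * g x) x := by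
      by_cases hx : x ∈ s <;> simp [hx]
    have hF : ⇑(SimpleFunc.piecewise s hs (.const X c) (.const X 0)) = s.indicator fun _ => c := rfl
    rw [hF, VectorMeasure.integral_indicator hs, VectorMeasure.integral_const]
    simp_rw [hind]
    rw [integral_indicator hs, integral_const_mul, ← withDensityᵥ_apply hg hs]
    simp [VectorMeasure.restrict_apply, hs]
  | add _ hF hG =>
    rename_i F G _
    obtain ⟨C, hC⟩ := F.exists_forall_norm_le
    obtain ⟨D, hD⟩ := G.exists_forall_norm_le
    simp only [SimpleFunc.coe_add, Pi.add_apply, add_mul]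
    rw [VectorMeasure.integral_add (integrable_of_forall_norm_le _ F.measurable hC)
        (integrable_of_forall_norm_le _ G.measurable hD), hF, hG,
      integral_add (hg.bdd_mul F.measurable.aestronglyMeasurable (ae_of_all _ hC))
        (hg.bdd_mul G.measurable.aestronglyMeasurable (ae_of_all _ hD))]

lemma integral_withDensityᵥ {p : Measure X} {g : X → ℂ} (hg : Integrable g p) {f : X → ℂ}
    (hf : Measurable f) {C : ℝ} (hC : ∀ x, ‖f x‖ ≤ C) :
    (p.withDensityᵥ g).integral f (ContinuousLinearMap.mul ℝ ℂ) = ∫ x, f x * g x ∂p := by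
  let F := hf.stronglyMeasurable.approxBounded C
  have hF (x : X) : Tendsto (fun k => F k x) atTop (𝓝 (f x)) :=
    hf.stronglyMeasurable.tendsto_approxBounded_of_norm_le (hC x)
  have hFC (k : ℕ) (x : X) : ‖F k x‖ ≤ C :=
    hf.stronglyMeasurable.norm_approxBounded_le ((norm_nonneg _).trans (hC x)) k x
  have hleft := VectorMeasure.tendsto_integral_of_dominated_convergence
    (μ := p.withDensityᵥ g) (B := ContinuousLinearMap.mul ℝ ℂ) (fun _ => C)
    (fun k => (F k).measurable.aestronglyMeasurable) (integrable_const C)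
    (fun k => ae_of_all _ (hFC k)) (ae_of_all _ hF)
  have hright : Tendsto (fun k => ∫ x, F k x * g x ∂p) atTop (𝓝 (∫ x, f x * g x ∂p)) := by
    refine tendsto_integral_of_dominated_convergence (fun x => C * ‖g x‖)
      (fun k => (F k).measurable.aestronglyMeasurable.mul hg.aestronglyMeasurable)
      (hg.norm.const_mul C) (fun k => ae_of_all _ fun x => ?_)
      (ae_of_all _ fun x => (hF x).mul_const _)
    rw [norm_mul]
    gcongr
    exact hFC k x
  simp only [integral_simpleFunc_withDensityᵥ hg] at hleft
  exact tendsto_nhds_unique hleft hright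

lemma exists_eq_withDensityᵥ_of_signedMeasure {s : SignedMeasure X} {p : Measure X} [SigmaFinite p]
    (h : ∀ t, p t = 0 → s t = 0) : ∃ r : X → ℝ, Integrable r p ∧ s = p.withDensityᵥ r := by
  refine ⟨s.rnDeriv p, SignedMeasure.integrable_rnDeriv s p,
    (SignedMeasure.withDensityᵥ_rnDeriv_eq s p (.mk fun t ht h₀ => h t ?_)).symm⟩
  rwa [Measure.toENNRealVectorMeasure_apply_measurable ht] at h₀

lemma exists_eq_withDensityᵥ (μ : ComplexMeasure X) :
    ∃ (p : Measure X) (g : X → ℂ), IsFiniteMeasure p ∧ Integrable g p ∧ μ = p.withDensityᵥ g := by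
  have hnull (t : Set X) (ht : μ.variation t = 0) : μ t = 0 := by
    simpa [ht] using VectorMeasure.enorm_measure_le_variation μ t
  obtain ⟨r, hr, hμr⟩ := exists_eq_withDensityᵥ_of_signedMeasure (s := ComplexMeasure.re μ)
    fun t ht => congrArg Complex.re (hnull t ht)
  obtain ⟨q, hq, hμq⟩ := exists_eq_withDensityᵥ_of_signedMeasure (s := ComplexMeasure.im μ)
    fun t ht => congrArg Complex.im (hnull t ht)
  have hrq : Integrable (fun x => (r x : ℂ) + q x * Complex.I) μ.variation :=
    hr.ofReal.add (hq.ofReal.mul_const _)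
  refine ⟨μ.variation, _, inferInstance, hrq, ?_⟩
  ext t ht
  have hre : (μ t).re = ∫ x in t, r x ∂μ.variation :=
    (congrArg (· t) hμr).trans (withDensityᵥ_apply hr ht)
  have him : (μ t).im = ∫ x in t, q x ∂μ.variation :=
    (congrArg (· t) hμq).trans (withDensityᵥ_apply hq ht)
  rw [withDensityᵥ_apply hrq ht, integral_add hr.restrict.ofReal (hq.restrict.ofReal.mul_const _),
    integral_mul_const, integral_complex_ofReal, integral_complex_ofReal, ← hre, ← him,
    Complex.re_add_im]

lemma prod_withDensityᵥ {p : Measure X} {q : Measure Y} [SFinite p] [SFinite q] {g : X → ℂ}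
    {h : Y → ℂ} (hg : Integrable g p) (hh : Integrable h q) :
    (p.withDensityᵥ g).prod (q.withDensityᵥ h) (ContinuousLinearMap.mul ℝ ℂ) =
      (p.prod q).withDensityᵥ fun z => g z.1 * h z.2 := by
  refine VectorMeasure.prod_eq_of_forall_apply_prod fun s t hs ht => ?_
  rw [withDensityᵥ_apply (hg.mul_prod hh) (hs.prod ht), setIntegral_prod_mul,
    withDensityᵥ_apply hg hs, withDensityᵥ_apply hh ht, ContinuousLinearMap.mul_apply']

lemma integral_smul_complexMeasure (μ : ComplexMeasure X) (c : ℂ) {f : X → ℂ} (hf : Measurable f)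
    {C : ℝ} (hC : ∀ x, ‖f x‖ ≤ C) :
    (c • μ).integral f (ContinuousLinearMap.mul ℝ ℂ) =
      c * μ.integral f (ContinuousLinearMap.mul ℝ ℂ) := by
  obtain ⟨p, g, -, hg, rfl⟩ := exists_eq_withDensityᵥ μ
  rw [← withDensityᵥ_smul, integral_withDensityᵥ (hg.smul c) hf hC, integral_withDensityᵥ hg hf hC,
    ← integral_const_mul]
  simp only [Pi.smul_apply, smul_eq_mul, mul_left_comm]

lemma integral_withDensity_ofReal_sub {p : Measure X} {r : X → ℝ} (hr : Integrable r p)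
    {f : X → ℂ} (hf : Measurable f) {C : ℝ} (hC : ∀ x, ‖f x‖ ≤ C) :
    ∫ x, f x ∂(p.withDensity fun x => ENNReal.ofReal (r x)) -
      ∫ x, f x ∂(p.withDensity fun x => ENNReal.ofReal (-r x)) = ∫ x, f x * r x ∂p := by
  have hwd {s : X → ℝ} (hs : Integrable s p) :
      ∫ x, f x ∂(p.withDensity fun x => ENNReal.ofReal (s x)) =
        ∫ x, f x * (max (s x) 0 : ℝ) ∂p := by
    rw [integral_withDensity_eq_integral_toReal_smul₀ hs.aemeasurable.ennreal_ofReal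
      (ae_of_all _ fun _ => ENNReal.ofReal_lt_top)]
    simp only [ENNReal.toReal_ofReal', Complex.real_smul, mul_comm]
  have hint {s : X → ℝ} (hs : Integrable s p) :
      Integrable (fun x => f x * (max (s x) 0 : ℝ)) p :=
    hs.pos_part.ofReal.bdd_mul hf.aestronglyMeasurable (ae_of_all _ hC)
  have hr' : Integrable (fun x => -r x) p := hr.neg
  rw [hwd hr, hwd hr', ← integral_sub (hint hr) (hint hr')]
  simp only [← mul_sub, ← Complex.ofReal_sub, max_zero_sub_max_neg_zero_eq_self]

end Density

section DensityParts

variable {n : ℕ} {p : Measure (Eucl n)} {g : Eucl n → ℂ}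

/-- The positive and negative parts of `Re g dp` and `Im g dp`: the four positive measures into
which the complex measure with density `g` with respect to `p` decomposes. -/
def densityParts (p : Measure (Eucl n)) (g : Eucl n → ℂ) : Fin 4 → Measure (Eucl n) :=
  ![p.withDensity fun x => ENNReal.ofReal (g x).re,
    p.withDensity fun x => ENNReal.ofReal (-(g x).re),
    p.withDensity fun x => ENNReal.ofReal (g x).im,
    p.withDensity fun x => ENNReal.ofReal (-(g x).im)]

lemma isFiniteMeasure_densityParts (hg : Integrable g p) (i : Fin 4) :
    IsFiniteMeasure (densityParts p g i) := by
  fin_cases i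
  · exact isFiniteMeasure_withDensity_ofReal hg.re.2
  · exact isFiniteMeasure_withDensity_ofReal hg.re.neg.2
  · exact isFiniteMeasure_withDensity_ofReal hg.im.2
  · exact isFiniteMeasure_withDensity_ofReal hg.im.neg.2

lemma densityParts_absolutelyContinuous (p : Measure (Eucl n)) (g : Eucl n → ℂ) (i : Fin 4) :
    densityParts p g i ≪ p := by
  fin_cases i <;> exact withDensity_absolutelyContinuous _ _

lemma decompIntegral_densityParts (hg : Integrable g p) {f : Eucl n → ℂ} (hf : Measurable f)
    {C : ℝ} (hC : ∀ x, ‖f x‖ ≤ C) :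
    decompIntegral (densityParts p g) f = ∫ x, f x * g x ∂p := by
  have hre := hg.re.ofReal (𝕜 := ℂ).bdd_mul hf.aestronglyMeasurable (ae_of_all _ hC)
  have him := hg.im.ofReal (𝕜 := ℂ).bdd_mul hf.aestronglyMeasurable (ae_of_all _ hC)
  calc decompIntegral (densityParts p g) f
      = ∫ x, f x * (g x).re ∂p + Complex.I * ∫ x, f x * (g x).im ∂p :=
        congrArg₂ (· + Complex.I * ·) (integral_withDensity_ofReal_sub hg.re hf hC)
          (integral_withDensity_ofReal_sub hg.im hf hC)
    _ = ∫ x, f x * (g x).re + Complex.I * (f x * (g x).im) ∂p := by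
        rw [← integral_const_mul]
        exact (integral_add hre (him.const_mul _)).symm
    _ = ∫ x, f x * g x ∂p := by
        congr with x
        conv_rhs => rw [← Complex.re_add_im (g x)]
        ring

lemma setIntegral_eq_densityParts (hg : Integrable g p) {s : Set (Eucl n)}
    (hs : MeasurableSet s) :
    ∫ x in s, g x ∂p = ((densityParts p g 0).real s - (densityParts p g 1).real s : ℂ) +
      Complex.I * ((densityParts p g 2).real s - (densityParts p g 3).real s : ℂ) := by
  have hind (x : Eucl n) : s.indicator (fun _ => (1 : ℂ)) x * g x = s.indicator g x := by
    by_cases hx : x ∈ s <;> simp [hx]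
  have h := decompIntegral_densityParts hg (measurable_const.indicator hs)
    (norm_indicator_le_norm_self fun _ => (1 : ℂ))
  simp only [hind, integral_indicator hs, decompIntegral, integral_const,
    measureReal_restrict_apply_univ, Complex.real_smul, mul_one] at h
  exact h.symm

end DensityParts

section CharFn

variable {n : ℕ}

lemma measurable_exp_inner (z : Eucl n) :
    Measurable fun x : Eucl n => Complex.exp (Complex.I * (inner ℝ z x : ℝ)) := by
  fun_prop

lemma norm_exp_inner_le (z x : Eucl n) :
    ‖Complex.exp (Complex.I * (inner ℝ z x : ℝ))‖ ≤ 1 := by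
  rw [mul_comm, Complex.norm_exp_ofReal_mul_I]

lemma integrable_exp_inner (μ : ComplexMeasure (Eucl n)) (z : Eucl n) :
    μ.Integrable fun x => Complex.exp (Complex.I * (inner ℝ z x : ℝ)) :=
  integrable_of_forall_norm_le μ (measurable_exp_inner z) (norm_exp_inner_le z)

lemma enorm_charFn_le (μ : ComplexMeasure (Eucl n)) (z : Eucl n) :
    ‖charFn μ z‖ₑ ≤ μ.variation univ := by
  have hexp (x : Eucl n) : ‖Complex.exp (Complex.I * (inner ℝ z x : ℝ))‖ₑ ≤ 1 := by
    rw [← ofReal_norm]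
    exact ENNReal.ofReal_le_one.2 (norm_exp_inner_le z x)
  simpa only [charFn, ContinuousLinearMap.opENorm_mul, one_mul] using
    VectorMeasure.enorm_integral_le_of_enorm_le_const (μ := μ) (B := ContinuousLinearMap.mul ℝ ℂ)
      (ae_of_all _ hexp)

lemma charFn_add (μ ν : ComplexMeasure (Eucl n)) (z : Eucl n) :
    charFn (μ + ν) z = charFn μ z + charFn ν z :=
  VectorMeasure.integral_add_vectorMeasure (integrable_exp_inner μ z) (integrable_exp_inner ν z)

lemma charFn_sub (μ ν : ComplexMeasure (Eucl n)) (z : Eucl n) :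
    charFn (μ - ν) z = charFn μ z - charFn ν z :=
  VectorMeasure.integral_sub_vectorMeasure (integrable_exp_inner μ z) (integrable_exp_inner ν z)

lemma charFn_smul (c : ℂ) (μ : ComplexMeasure (Eucl n)) (z : Eucl n) :
    charFn (c • μ) z = c * charFn μ z :=
  integral_smul_complexMeasure μ c (measurable_exp_inner z) (norm_exp_inner_le z)

lemma charFn_sum {ι : Type*} (s : Finset ι) (μ : ι → ComplexMeasure (Eucl n)) (z : Eucl n) :
    charFn (∑ i ∈ s, μ i) z = ∑ i ∈ s, charFn (μ i) z :=
  VectorMeasure.integral_finsetSum_vectorMeasure fun i _ => integrable_exp_inner (μ i) z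

lemma charFn_delta0 (z : Eucl n) : charFn (delta0 n) z = 1 := by
  rw [charFn, delta0, VectorMeasure.integral_dirac]
  simp

lemma charFn_withDensityᵥ {p : Measure (Eucl n)} {g : Eucl n → ℂ} (hg : Integrable g p)
    (z : Eucl n) :
    charFn (p.withDensityᵥ g) z = ∫ x, Complex.exp (Complex.I * (inner ℝ z x : ℝ)) * g x ∂p :=
  integral_withDensityᵥ hg (measurable_exp_inner z) (norm_exp_inner_le z)

lemma charFn_volume_withDensityᵥ {g : Eucl n → ℂ} (hg : Integrable g) (z : Eucl n) :
    charFn (volume.withDensityᵥ g) z = 𝓕 g (-(2 * Real.pi)⁻¹ • z) := by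
  rw [charFn_withDensityᵥ hg, Real.fourier_eq']
  congr with x
  rw [real_inner_smul_right, real_inner_comm, smul_eq_mul]
  have : (Real.pi : ℂ) ≠ 0 := Complex.ofReal_ne_zero.2 Real.pi_ne_zero
  push_cast
  field_simp

lemma charFn_conv (μ ν : ComplexMeasure (Eucl n)) (z : Eucl n) :
    charFn (conv μ ν) z = charFn μ z * charFn ν z := by
  obtain ⟨p, g, _, hg, rfl⟩ := exists_eq_withDensityᵥ μ
  obtain ⟨q, h, _, hh, rfl⟩ := exists_eq_withDensityᵥ ν
  have hmeas : Measurable fun x : Eucl n × Eucl n =>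
      Complex.exp (Complex.I * (inner ℝ z (x.1 + x.2) : ℝ)) := by fun_prop
  have hbound (x : Eucl n × Eucl n) := norm_exp_inner_le z (x.1 + x.2)
  rw [charFn, conv, VectorMeasure.integral_map (by fun_prop)
      (measurable_exp_inner z).aestronglyMeasurable (integrable_of_forall_norm_le _ hmeas hbound),
    prod_withDensityᵥ hg hh, integral_withDensityᵥ (hg.mul_prod hh) hmeas hbound,
    charFn_withDensityᵥ hg, charFn_withDensityᵥ hh, ← integral_prod_mul]
  congr with x
  rw [inner_add_right, Complex.ofReal_add, mul_add, Complex.exp_add]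
  ring

lemma charFn_convPow (ν : ComplexMeasure (Eucl n)) (j : ℕ) (z : Eucl n) :
    charFn (convPow ν j) z = charFn ν z ^ j := by
  induction j with
  | zero => rw [convPow, charFn_delta0, pow_zero]
  | succ j ih => rw [convPow, charFn_conv, ih, pow_succ']

lemma charFn_withDensityᵥ_eq_charFun {p : Measure (Eucl n)} {g : Eucl n → ℂ} (hg : Integrable g p)
    (z : Eucl n) :
    charFn (p.withDensityᵥ g) z =
      (charFun (densityParts p g 0) z - charFun (densityParts p g 1) z) +
        Complex.I * (charFun (densityParts p g 2) z - charFun (densityParts p g 3) z) := by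
  rw [charFn_withDensityᵥ hg,
    ← decompIntegral_densityParts hg (measurable_exp_inner z) (norm_exp_inner_le z)]
  simp only [decompIntegral, charFun_apply, real_inner_comm z,
    mul_comm Complex.I (Complex.ofReal _)]

lemma eq_zero_of_charFn_eq_zero {μ : ComplexMeasure (Eucl n)} (h : ∀ z, charFn μ z = 0) :
    μ = 0 := by
  obtain ⟨p, g, _, hg, rfl⟩ := exists_eq_withDensityᵥ μ
  have := isFiniteMeasure_densityParts hg
  let ρ := densityParts p g
  have hadd (z : Eucl n) : (charFun (ρ 0) z - charFun (ρ 1) z) +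
      Complex.I * (charFun (ρ 2) z - charFun (ρ 3) z) = 0 :=
    (charFn_withDensityᵥ_eq_charFun hg z).symm.trans (h z)
  -- Conjugating the equation at `-z` changes the sign of the imaginary part only.
  have hsub (z : Eucl n) : (charFun (ρ 0) z - charFun (ρ 1) z) -
      Complex.I * (charFun (ρ 2) z - charFun (ρ 3) z) = 0 := by
    have hconj := congrArg (starRingEnd ℂ) (hadd (-z))
    simp only [charFun_neg, map_add, map_sub, map_mul, Complex.conj_conj, Complex.conj_I,
      map_zero] at hconj
    linear_combination hconj
  have h01 : densityParts p g 0 = densityParts p g 1 :=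
    Measure.ext_of_charFun <| funext fun z => by
      linear_combination (hadd z + hsub z) / 2
  have h23 : densityParts p g 2 = densityParts p g 3 :=
    Measure.ext_of_charFun <| funext fun z => by
      linear_combination (-Complex.I) * (hadd z - hsub z) / 2 +
        (charFun (ρ 2) z - charFun (ρ 3) z) * Complex.I_sq
  ext s hs
  simp [withDensityᵥ_apply hg hs, setIntegral_eq_densityParts hg hs, h01, h23]

lemma ext_of_charFn {μ ν : ComplexMeasure (Eucl n)} (h : ∀ z, charFn μ z = charFn ν z) :
    μ = ν :=
  sub_eq_zero.1 <| eq_zero_of_charFn_eq_zero fun z => by rw [charFn_sub, h, sub_self]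

end CharFn

section Exponential

section Summation

variable {X : Type*} [MeasurableSpace X] {ν : ℕ → ComplexMeasure X}

lemma summable_apply_of_tsum_variation_ne_top (h : ∑' j, (ν j).variation univ ≠ ⊤) (s : Set X) :
    Summable fun j => ν j s :=
  (tsum_enorm_ne_top_iff_summable_norm.1 <| ne_top_of_le_ne_top h <| ENNReal.tsum_le_tsum fun j =>
    (VectorMeasure.enorm_measure_le_variation (ν j) s).trans
      (measure_mono (subset_univ s))).of_norm

lemma summable_apply_iUnion_of_tsum_variation_ne_top (h : ∑' j, (ν j).variation univ ≠ ⊤)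
    {f : ℕ → Set X} (hf : ∀ i, MeasurableSet (f i)) (hd : Pairwise (Function.onFun Disjoint f)) :
    Summable fun q : ℕ × ℕ => ν q.1 (f q.2) := by
  refine (tsum_enorm_ne_top_iff_summable_norm.1 (ne_top_of_le_ne_top h ?_)).of_norm
  calc ∑' q : ℕ × ℕ, ‖ν q.1 (f q.2)‖ₑ
      = ∑' j, ∑' i, ‖ν j (f i)‖ₑ := ENNReal.tsum_prod (f := fun j i => ‖ν j (f i)‖ₑ)
    _ ≤ ∑' j, ∑' i, (ν j).variation (f i) := by
        gcongr
        exact VectorMeasure.enorm_measure_le_variation _ _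
    _ = ∑' j, (ν j).variation (⋃ i, f i) := by simp only [measure_iUnion hd hf]
    _ ≤ ∑' j, (ν j).variation univ := by
        gcongr
        exact subset_univ _

/-- The sum of a series of complex measures whose total variation norms are summable. -/
def tsumComplexMeasure (ν : ℕ → ComplexMeasure X) (h : ∑' j, (ν j).variation univ ≠ ⊤) :
    ComplexMeasure X where
  measureOf' s := ∑' j, ν j s
  empty' := by simp
  not_measurable' s hs := by simp [VectorMeasure.not_measurable _ hs]
  m_iUnion' f hf hd := by
    have hsum := (summable_apply_iUnion_of_tsum_variation_ne_top h hf hd).hasSum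
    have hrow := hsum.prod_fiberwise fun j => (ν j).m_iUnion hf hd
    have hcol := ((Equiv.prodComm ℕ ℕ).hasSum_iff.2 hsum).prod_fiberwise fun i =>
      (summable_apply_of_tsum_variation_ne_top h (f i)).hasSum
    rwa [← hrow.tsum_eq] at hcol

lemma variation_tsumComplexMeasure_sub_sum_le (h : ∑' j, (ν j).variation univ ≠ ⊤) (N : ℕ) :
    (tsumComplexMeasure ν h - ∑ j ∈ Finset.range N, ν j).variation ≤
      Measure.sum fun j => (ν (j + N)).variation := by
  refine VectorMeasure.variation_le_of_forall_enorm_le fun s hs => ?_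
  have htail : (tsumComplexMeasure ν h - ∑ j ∈ Finset.range N, ν j) s = ∑' j, ν (j + N) s := by
    rw [sub_apply, FunLike.coe_sum, Finset.sum_apply, sub_eq_iff_eq_add']
    exact ((summable_apply_of_tsum_variation_ne_top h s).sum_add_tsum_nat_add N).symm
  rw [htail, Measure.sum_apply _ hs]
  exact enorm_tsum_le_tsum_enorm.trans
    (ENNReal.tsum_le_tsum fun j => VectorMeasure.enorm_measure_le_variation _ _)

lemma tendsto_variation_tsumComplexMeasure_sub_sum (h : ∑' j, (ν j).variation univ ≠ ⊤) :
    Tendsto (fun N => (tsumComplexMeasure ν h - ∑ j ∈ Finset.range N, ν j).variation univ)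
      atTop (𝓝 0) := by
  refine tendsto_of_tendsto_of_tendsto_of_le_of_le tendsto_const_nhds
    (ENNReal.tendsto_sum_nat_add _ h) (fun _ => zero_le) fun N => ?_
  simpa only [Measure.sum_apply _ MeasurableSet.univ] using
    variation_tsumComplexMeasure_sub_sum_le h N univ

end Summation

variable {n : ℕ}

lemma variation_conv_univ_le (μ ν : ComplexMeasure (Eucl n)) :
    (conv μ ν).variation univ ≤ μ.variation univ * ν.variation univ := by
  refine (VectorMeasure.variation_map_le univ).trans ?_
  rw [Measure.map_apply (by fun_prop) MeasurableSet.univ, preimage_univ]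
  refine (VectorMeasure.variation_prod_le univ).trans ?_
  rw [ContinuousLinearMap.opENorm_mul, one_smul, ← univ_prod_univ, Measure.prod_prod]

lemma variation_convPow_univ_le (ν : ComplexMeasure (Eucl n)) (j : ℕ) :
    (convPow ν j).variation univ ≤ ν.variation univ ^ j := by
  induction j with
  | zero => simp [convPow, delta0]
  | succ j ih =>
    rw [convPow, pow_succ']
    exact (variation_conv_univ_le _ _).trans (by gcongr)

lemma variation_inv_factorial_smul_convPow_univ_le (ν : ComplexMeasure (Eucl n)) (j : ℕ) :
    (((j.factorial : ℂ)⁻¹) • convPow ν j).variation univ ≤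
      ENNReal.ofReal (ν.variation.real univ ^ j / j.factorial) := by
  have hpow : ENNReal.ofReal (ν.variation.real univ ^ j) = ν.variation univ ^ j := by
    rw [ENNReal.ofReal_pow measureReal_nonneg, ofReal_measureReal]
  have hfact : ENNReal.ofReal ((j.factorial : ℝ)⁻¹) = ‖(j.factorial : ℂ)⁻¹‖ₑ := by
    rw [← ofReal_norm, norm_inv, Complex.norm_natCast]
  rw [VectorMeasure.variation_smul, Measure.smul_apply, div_eq_inv_mul,
    ENNReal.ofReal_mul (by positivity), hpow, hfact]
  exact mul_le_mul_right (variation_convPow_univ_le ν j) _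

lemma exists_isExp (ν : ComplexMeasure (Eucl n)) : ∃ μ, IsExp ν μ :=
  ⟨_, tendsto_variation_tsumComplexMeasure_sub_sum <| ne_top_of_le_ne_top
    (Real.summable_pow_div_factorial (ν.variation.real univ)).tsum_ofReal_ne_top
    (ENNReal.tsum_le_tsum (variation_inv_factorial_smul_convPow_univ_le ν))⟩

lemma IsExp.charFn_eq {ν μ : ComplexMeasure (Eucl n)} (h : IsExp ν μ) (z : Eucl n) :
    charFn μ z = Complex.exp (charFn ν z) := by
  have hpartial (N : ℕ) :
      charFn (μ - ∑ j ∈ Finset.range N, ((j.factorial : ℂ)⁻¹) • convPow ν j) z =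
        charFn μ z - ∑ j ∈ Finset.range N, charFn ν z ^ j / j.factorial := by
    simp only [charFn_sub, charFn_sum, charFn_smul, charFn_convPow, div_eq_inv_mul]
  have hlim : Tendsto (fun N : ℕ =>
      charFn μ z - ∑ j ∈ Finset.range N, charFn ν z ^ j / j.factorial) atTop (𝓝 0) := by
    rw [tendsto_zero_iff_enorm_tendsto_zero]
    refine tendsto_of_tendsto_of_tendsto_of_le_of_le tendsto_const_nhds h (fun _ => zero_le)
      fun N => ?_
    simp only [← hpartial]
    exact enorm_charFn_le _ z
  have hexp := (NormedSpace.expSeries_div_hasSum_exp (charFn ν z)).tendsto_sum_nat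
  rw [← Complex.exp_eq_exp_ℂ] at hexp
  exact sub_eq_zero.1 (tendsto_nhds_unique (hexp.const_sub (charFn μ z)) hlim)

lemma IsExp.isInvertible {ν μ : ComplexMeasure (Eucl n)} (h : IsExp ν μ) : IsInvertible μ := by
  obtain ⟨μ', hμ'⟩ := exists_isExp ((-1 : ℂ) • ν)
  refine ⟨μ', ext_of_charFn fun z => ?_⟩
  rw [charFn_conv, hμ'.charFn_eq, h.charFn_eq, charFn_smul, charFn_delta0, ← Complex.exp_add,
    neg_one_mul, neg_add_cancel, Complex.exp_zero]

end Exponential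

section LevyKhintchine

variable {n : ℕ} {ν : AwayFromZero n → ℂ} {g : Eucl n → ℂ}

lemma isLevyDecomp_densityParts [Nonempty (Fin n)] (hg : Integrable g) (hν : HasDensity ν g) :
    IsLevyDecomp (densityParts volume g) ν := by
  have := isFiniteMeasure_densityParts hg
  have hlt (i : Fin 4) (φ : Eucl n → ℝ) (hφ : ∀ x, φ x ≤ 1) :
      ∫⁻ x, ENNReal.ofReal (φ x) ∂(densityParts volume g i) < ⊤ :=
    IsFiniteMeasure.lintegral_lt_top_of_bounded_to_ennreal _
      ⟨1, fun x => ENNReal.ofReal_le_one.2 (hφ x)⟩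
  refine ⟨fun i => ⟨densityParts_absolutelyContinuous _ g i (measure_singleton 0),
    hlt i _ fun x => min_le_left _ _⟩, fun i => hlt i _ fun x => min_le_left _ _, fun B => ?_⟩
  rw [hν B, setIntegral_eq_densityParts hg B.2.1]

lemma levyIntegral_of_hasDensity [Nonempty (Fin n)] (hg : Integrable g) (hν : HasDensity ν g)
    (z : Eucl n) :
    levyIntegral ν (fun x => Complex.exp (Complex.I * (inner ℝ z x : ℝ)) - 1) =
      charFn (volume.withDensityᵥ g) z - ∫ x, g x := by
  have hmeas := (measurable_exp_inner z).sub_const 1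
  have hbound (x : Eucl n) : ‖Complex.exp (Complex.I * (inner ℝ z x : ℝ)) - 1‖ ≤ 1 + 1 :=
    (norm_sub_le _ _).trans (add_le_add (norm_exp_inner_le z x) norm_one.le)
  have hint : Integrable fun x => Complex.exp (Complex.I * (inner ℝ z x : ℝ)) * g x :=
    hg.bdd_mul (measurable_exp_inner z).aestronglyMeasurable (ae_of_all _ (norm_exp_inner_le z))
  rw [levyIntegral_eq (isLevyDecomp_densityParts hg hν) hmeas (norm_exp_sub_one_le z),
    decompIntegral_densityParts hg hmeas hbound, charFn_withDensityᵥ hg, ← integral_sub hint hg]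
  simp only [sub_mul, one_mul]

lemma charFn_ne_zero_of_isInvertible {μ : ComplexMeasure (Eucl n)} (h : IsInvertible μ)
    (z : Eucl n) : charFn μ z ≠ 0 := by
  obtain ⟨μ', hμ'⟩ := h
  have hmul : charFn μ' z * charFn μ z = 1 := by rw [← charFn_conv, hμ', charFn_delta0]
  exact right_ne_zero_of_mul_eq_one hmul

lemma charFn_ne_zero_of_mem_CLK {μ : ComplexMeasure (Eucl n)} (h : μ ∈ CLK n) (z : Eucl n) :
    charFn μ z ≠ 0 := by
  obtain ⟨c, γ, ν, h⟩ := h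
  rw [h.charFn_eq]
  exact mul_ne_zero h.ne_zero (Complex.exp_ne_zero _)

lemma exists_charFn_eq_mul_exp (hn : 2 ≤ n) {α : ℂ} (hα : α ≠ 0) {f : Eucl n → ℂ}
    (hf : Integrable f) (hne : ∀ z, charFn (α • delta0 n + volume.withDensityᵥ f) z ≠ 0) :
    ∃ g : Eucl n → ℂ, Integrable g ∧ ∀ z, charFn (α • delta0 n + volume.withDensityᵥ f) z =
      α * Complex.exp (charFn (volume.withDensityᵥ g) z) := by
  have hrank : 1 < Module.rank ℝ (Eucl n) := by
    rw [← Module.finrank_eq_rank, finrank_euclideanSpace_fin]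
    exact_mod_cast hn
  have hf' : Integrable (α⁻¹ • f) := hf.smul _
  have hfactor (z : Eucl n) : charFn (α • delta0 n + volume.withDensityᵥ f) z =
      α * (1 + 𝓕 (α⁻¹ • f) (-(2 * Real.pi)⁻¹ • z)) := by
    rw [← charFn_volume_withDensityᵥ hf', withDensityᵥ_smul, charFn_add, charFn_smul, charFn_smul,
      charFn_delta0, mul_add, mul_inv_cancel_left₀ hα]
  have hne' (ξ : Eucl n) : 1 + 𝓕 (α⁻¹ • f) ξ ≠ 0 := by
    have hξ : -(2 * Real.pi)⁻¹ • -(2 * Real.pi) • ξ = ξ := by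
      rw [← inv_neg, inv_smul_smul₀ (neg_ne_zero.2 Real.two_pi_pos.ne')]
    have h := hne (-(2 * Real.pi) • ξ)
    rw [hfactor, hξ] at h
    exact right_ne_zero_of_mul h
  obtain ⟨g, hg, hgf⟩ := exists_exp_fourier_eq hrank hf' hne'
  exact ⟨g, hg, fun z => by rw [hfactor, charFn_volume_withDensityᵥ hg, hgf]⟩

lemma exists_hasLKRep_of_charFn_ne_zero (hn : 2 ≤ n) {α : ℂ} (hα : α ≠ 0) {f : Eucl n → ℂ}
    (hf : Integrable f) (hne : ∀ z, charFn (α • delta0 n + volume.withDensityᵥ f) z ≠ 0) :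
    ∃ (c : ℂ) (ν : AwayFromZero n → ℂ), HasLKRep (α • delta0 n + volume.withDensityᵥ f) c 0 ν ∧
      ∃ g : Eucl n → ℂ, Integrable g ∧ HasDensity ν g := by
  have : Nonempty (Fin n) := ⟨⟨0, by omega⟩⟩
  obtain ⟨g, hg, hfg⟩ := exists_charFn_eq_mul_exp hn hα hf hne
  have hν : HasDensity (fun B : AwayFromZero n => ∫ x in B.1, g x) g := fun _ => rfl
  refine ⟨α * Complex.exp (∫ x, g x), _, ⟨mul_ne_zero hα (Complex.exp_ne_zero _),
    ⟨_, isLevyDecomp_densityParts hg hν⟩, fun z => ?_⟩, g, hg, hν⟩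
  rw [hfg, levyIntegral_of_hasDensity hg hν, mul_assoc, ← Complex.exp_add, inner_zero_left,
    Complex.ofReal_zero, mul_zero, zero_add, add_sub_cancel]

lemma HasLKRep.isExp [Nonempty (Fin n)] {μ : ComplexMeasure (Eucl n)} {c : ℂ}
    (h : HasLKRep μ c 0 ν) (hg : Integrable g) (hν : HasDensity ν g) :
    IsExp ((Complex.log c - ∫ x, g x) • delta0 n + volume.withDensityᵥ g) μ := by
  obtain ⟨μ', hμ'⟩ := exists_isExp
    ((Complex.log c - ∫ x, g x) • delta0 n + volume.withDensityᵥ g)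
  suffices μ' = μ from this ▸ hμ'
  refine ext_of_charFn fun z => ?_
  calc charFn μ' z
      = Complex.exp (Complex.log c + (charFn (volume.withDensityᵥ g) z - ∫ x, g x)) := by
        rw [hμ'.charFn_eq, charFn_add, charFn_smul, charFn_delta0]
        ring_nf
    _ = charFn μ z := by
        rw [Complex.exp_add, Complex.exp_log h.ne_zero, h.charFn_eq,
          levyIntegral_of_hasDensity hg hν, inner_zero_left, Complex.ofReal_zero, mul_zero,
          zero_add]

end LevyKhintchine

end InvertibleMeasures

end

open InvertibleMeasures in
theorem theorem4p3 (n : ℕ) (hn : 2 ≤ n) (α : ℂ) (hα : α ≠ 0)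
    (f : EuclideanSpace ℝ (Fin n) → ℂ) (hf : MeasureTheory.Integrable f)
    (μ : MeasureTheory.ComplexMeasure (EuclideanSpace ℝ (Fin n)))
    (hμ : μ = α • delta0 n + MeasureTheory.volume.withDensityᵥ f) :
    List.TFAE [
      IsInvertible μ,
      μ ∈ CLK n,
      ∃ (c : ℂ) (ν : AwayFromZero n → ℂ), HasLKRep μ c 0 ν ∧
        ∃ g : EuclideanSpace ℝ (Fin n) → ℂ, MeasureTheory.Integrable g ∧ HasDensity ν g,
      ∃ ν' : MeasureTheory.ComplexMeasure (EuclideanSpace ℝ (Fin n)), IsExp ν' μ] := by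
  subst hμ
  have : Nonempty (Fin n) := ⟨⟨0, by omega⟩⟩
  tfae_have 1 → 3 := fun h =>
    exists_hasLKRep_of_charFn_ne_zero hn hα hf (charFn_ne_zero_of_isInvertible h)
  tfae_have 2 → 3 := fun h =>
    exists_hasLKRep_of_charFn_ne_zero hn hα hf (charFn_ne_zero_of_mem_CLK h)
  tfae_have 3 → 2 := fun ⟨c, ν, h, _⟩ => ⟨c, 0, ν, h⟩
  tfae_have 3 → 4 := fun ⟨_, _, h, _, hg, hν⟩ => ⟨_, h.isExp hg hν⟩
  tfae_have 4 → 1 := fun ⟨_, h⟩ => h.isInvertible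
  tfae_finish
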